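/- Let $G$ be a finite simple graph with maximum degree $\Delta$ and minimum degree $\delta$. A proper $k$-colouring $\sigma\colon V(G)\to\{1,\dots,k\}$ is $h$-conflict-free if for every vertex $v$ at least $\min\{h,\deg(v)\}$ colours appear exactly once in the neighbourhood $N(v)$, and $\chi^h_{\rm pcf}(G)$ denotes the least $k$ for which $G$ has a proper $h$-conflict-free $k$-colouring. Then for every integer $h\ge 1$ with $h\ge 20\log\Delta$ (natural logarithm) and $\delta\ge 16h$, one has \[ \chi^h_{\rm pcf}(G)\le 4\Delta. \] -/

import Mathlib

namespace SimpleGraph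

/-- The solitary colours of the vertex `v` in the proper colouring `σ`: the colours that appear
exactly once in the (open) neighbourhood of `v`. -/
def solitaryColours {V α : Type*} (G : SimpleGraph V) (σ : G.Coloring α) (v : V) : Set α :=
  {c | ∃! u, G.Adj v u ∧ σ u = c}

/-- The proper colouring `σ` (with colours `Fin k`) is `h`-conflict-free: every vertex `v` has at
least `min {h, deg v}` solitary colours. -/
def IsPcfColouring {V : Type*} [Fintype V] (G : SimpleGraph V) [DecidableRel G.Adj]
    (h : ℕ) {k : ℕ} (σ : G.Coloring (Fin k)) : Prop :=
  ∀ v, min h (G.degree v) ≤ (G.solitaryColours σ v).ncard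

/-- The `h`-conflict-free chromatic number: the least `k` such that `G` admits a proper
`h`-conflict-free `k`-colouring (with value `⊤` if there were none, as for
`SimpleGraph.chromaticNumber`). -/
noncomputable def pcfChromaticNumber {V : Type*} [Fintype V] (G : SimpleGraph V)
    [DecidableRel G.Adj] (h : ℕ) : ℕ∞ :=
  ⨅ k ∈ {k : ℕ | ∃ σ : G.Coloring (Fin k), G.IsPcfColouring h σ}, (k : ℕ∞)

end SimpleGraph

/-! Apply the lopsided local lemma to a uniformly random proper colouring with `4Δ` colours, the bad
event at `v` being fewer than `h` unique colours on `N(v)`. Then some `S ⊆ N(v)` of size about `(d -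
h) / 2` only repeats colours of `N(v) \ S`. Fix the colours off `S`: greedy colouring leaves at
least `(3Δ)^s` proper extensions, of which at most `(d - s)^s` repeat. A union bound over `S` gives
probability at most `1 / (4Δ²)`, even conditionally on events independent of the colours on `N(v)`.
The carriers are `exists_avoiding_of_card_le`, `card_repeating_mul_le` and
`exists_repeating_subset`. -/

open Finset in
open scoped Classical in
/-- A counting form of the symmetric lopsided local lemma. -/
theorem Finset.exists_avoiding_of_card_le {Ω ι : Type*} [Fintype ι] (X : Finset Ω)
    (hX : X.Nonempty) (B : ι → Ω → Prop) (N : ι → Finset ι) (D : ℕ) (hD : 1 ≤ D)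
    (hN : ∀ i, #(N i) ≤ D)
    (hB : ∀ i, ∀ F : Finset ι, Disjoint F (N i) →
      4 * D * #{x ∈ X | B i x ∧ ∀ j ∈ F, ¬ B j x} ≤ #{x ∈ X | ∀ j ∈ F, ¬ B j x}) :
    ∃ x ∈ X, ∀ i, ¬ B i x := by
  have key : ∀ n : ℕ, ∀ F : Finset ι, #F = n → ∀ i,
      2 * D * #{x ∈ X | B i x ∧ ∀ j ∈ F, ¬ B j x} ≤ #{x ∈ X | ∀ j ∈ F, ¬ B j x} := by
    intro n
    induction n using Nat.strong_induction_on with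
    | _ n ih =>
    intro F hF i
    set F₂ := F \ N i with hF₂
    have h₂ := hB i F₂ Finset.sdiff_disjoint
    have hmono : #{x ∈ X | B i x ∧ ∀ j ∈ F, ¬ B j x} ≤ #{x ∈ X | B i x ∧ ∀ j ∈ F₂, ¬ B j x} := by
      refine card_le_card fun x => ?_
      simp only [mem_filter]
      exact fun ⟨a, b, c⟩ => ⟨a, b, fun j hj => c j (mem_sdiff.1 hj).1⟩
    -- By induction each of the at most `D` events in `F ∩ N i` has conditional probability at most
    -- `1 / (2D)`, so avoiding them all keeps half the mass.
    have hhalf : #{x ∈ X | ∀ j ∈ F₂, ¬ B j x} ≤ 2 * #{x ∈ X | ∀ j ∈ F, ¬ B j x} := by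
      rcases (F ∩ N i).eq_empty_or_nonempty with he | hne
      · have : F₂ = F := by rw [hF₂, sdiff_eq_self_iff_disjoint, disjoint_iff_inter_eq_empty, he]
        rw [this]; omega
      · have hlt : #F₂ < n := by
          have := card_sdiff_add_card_inter F (N i)
          have := hne.card_pos
          rw [hF₂]; omega
        have hcover : ({x ∈ X | ∀ j ∈ F₂, ¬ B j x} : Finset Ω) ⊆
            {x ∈ X | ∀ j ∈ F, ¬ B j x} ∪
              (F ∩ N i).biUnion fun t => {x ∈ X | B t x ∧ ∀ j ∈ F₂, ¬ B j x} := by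
          intro x hx
          simp only [mem_filter, mem_union, mem_biUnion, mem_inter] at hx ⊢
          by_cases h : ∀ j ∈ F, ¬ B j x
          · exact Or.inl ⟨hx.1, h⟩
          · push Not at h
            obtain ⟨j, hj, hjx⟩ := h
            refine Or.inr ⟨j, ⟨hj, ?_⟩, hx.1, hjx, hx.2⟩
            by_contra hjn
            exact hx.2 j (mem_sdiff.2 ⟨hj, hjn⟩) hjx
        have h1 := (card_le_card hcover).trans (card_union_le _ _)
        have h3 : 2 * D * #((F ∩ N i).biUnion fun t => {x ∈ X | B t x ∧ ∀ j ∈ F₂, ¬ B j x}) ≤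
            D * #{x ∈ X | ∀ j ∈ F₂, ¬ B j x} := by
          calc _ ≤ 2 * D * ∑ t ∈ F ∩ N i, #{x ∈ X | B t x ∧ ∀ j ∈ F₂, ¬ B j x} := by
                gcongr; exact card_biUnion_le
            _ = ∑ t ∈ F ∩ N i, 2 * D * #{x ∈ X | B t x ∧ ∀ j ∈ F₂, ¬ B j x} := mul_sum _ _ _
            _ ≤ ∑ t ∈ F ∩ N i, #{x ∈ X | ∀ j ∈ F₂, ¬ B j x} :=
                sum_le_sum fun t _ => ih _ hlt F₂ rfl t
            _ = #(F ∩ N i) * #{x ∈ X | ∀ j ∈ F₂, ¬ B j x} := by simp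
            _ ≤ _ := by
                gcongr; exact (card_le_card inter_subset_right).trans (hN i)
        have h4 : 2 * #((F ∩ N i).biUnion fun t => {x ∈ X | B t x ∧ ∀ j ∈ F₂, ¬ B j x}) ≤
            #{x ∈ X | ∀ j ∈ F₂, ¬ B j x} := by
          refine Nat.le_of_mul_le_mul_left ?_ hD
          linarith
        omega
    have h5 : 4 * D * #{x ∈ X | B i x ∧ ∀ j ∈ F, ¬ B j x} ≤
        4 * D * #{x ∈ X | B i x ∧ ∀ j ∈ F₂, ¬ B j x} := by gcongr
    linarith
  have hpos : ∀ F : Finset ι, 0 < #{x ∈ X | ∀ j ∈ F, ¬ B j x} := by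
    intro F
    induction F using Finset.induction_on with
    | empty => simpa using hX
    | insert i F _ ih =>
      have h := key _ F rfl i
      have hcover : ({x ∈ X | ∀ j ∈ F, ¬ B j x} : Finset Ω) ⊆
          {x ∈ X | ∀ j ∈ insert i F, ¬ B j x} ∪ {x ∈ X | B i x ∧ ∀ j ∈ F, ¬ B j x} := by
        intro x
        simp only [mem_filter, mem_union, mem_insert, forall_eq_or_imp]
        tauto
      have h1 := (card_le_card hcover).trans (card_union_le _ _)
      nlinarith
  obtain ⟨x, hx⟩ := card_pos.1 (hpos univ)
  rw [mem_filter] at hx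
  exact ⟨x, hx.1, fun i => hx.2 i (mem_univ i)⟩

namespace SimpleGraph

open Finset
open scoped Classical

variable {V : Type*} [Fintype V] (G : SimpleGraph V) [DecidableRel G.Adj] {k : ℕ}

/-! ### Counting proper colourings by recolouring a set -/

/-- The assignments of colours that are proper colourings of `G`. -/
noncomputable def properAssignments (k : ℕ) : Finset (V → Fin k) :=
  {f | ∀ a b, G.Adj a b → f a ≠ f b}

theorem mem_properAssignments {f : V → Fin k} :
    f ∈ G.properAssignments k ↔ ∀ a b, G.Adj a b → f a ≠ f b := by
  simp [properAssignments]

/-- An assignment that is proper off `S` has many proper modifications on `S`. -/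
theorem pow_le_card_properAssignments_eqOn (m : ℕ) (hm : m + G.maxDegree ≤ k) (S : Finset V) :
    ∀ f : V → Fin k, (∀ a b, a ∉ S → b ∉ S → G.Adj a b → f a ≠ f b) →
      m ^ #S ≤ #{g ∈ G.properAssignments k | ∀ u ∉ S, g u = f u} := by
  induction S using Finset.induction_on with
  | empty =>
    intro f hf
    rw [card_empty, pow_zero, Nat.one_le_iff_ne_zero, ← Nat.pos_iff_ne_zero, card_pos]
    exact ⟨f, by simpa [mem_properAssignments] using hf⟩
  | insert a S ha ih =>
    intro f hf
    -- Avoiding every neighbour's colour, even on vertices of `S` still to be recoloured, costs at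
    -- most the maximum degree.
    set C : Finset (Fin k) := univ \ (G.neighborFinset a).image f with hC
    have hCcard : m ≤ #C := by
      have h1 : _ ≤ #C := le_card_sdiff ((G.neighborFinset a).image f) (univ : Finset (Fin k))
      have h2 : #((G.neighborFinset a).image f) ≤ G.maxDegree :=
        card_image_le.trans (by simpa using G.degree_le_maxDegree a)
      rw [card_univ, Fintype.card_fin] at h1
      omega
    have hsub : (C.biUnion fun c => {g ∈ G.properAssignments k |
          ∀ u ∉ S, g u = Function.update f a c u}) ⊆
        {g ∈ G.properAssignments k | ∀ u ∉ insert a S, g u = f u} := by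
      intro g
      simp only [mem_biUnion, mem_filter, mem_insert, not_or]
      rintro ⟨c, -, hg, h⟩
      exact ⟨hg, fun u hu => by rw [h u hu.2, Function.update_of_ne hu.1]⟩
    refine le_trans ?_ (card_le_card hsub)
    rw [card_biUnion, card_insert_of_notMem ha, pow_succ']
    · calc m * m ^ #S ≤ #C * m ^ #S := by gcongr
        _ = ∑ c ∈ C, m ^ #S := by simp
        _ ≤ _ := by
          refine sum_le_sum fun c hc => ih _ ?_
          have hc' : ∀ u, G.Adj a u → f u ≠ c := by
            simpa [hC] using hc
          intro x y hx hy hxy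
          rcases eq_or_ne x a with rfl | hxa
          · rw [Function.update_self, Function.update_of_ne hxy.ne']
            exact (hc' y hxy).symm
          rcases eq_or_ne y a with rfl | hya
          · rw [Function.update_self, Function.update_of_ne hxa]
            exact hc' x hxy.symm
          rw [Function.update_of_ne hxa, Function.update_of_ne hya]
          exact hf x y (by simp [hxa, hx]) (by simp [hya, hy]) hxy
    · intro c _ c' _ hcc'
      refine Finset.disjoint_left.2 ?_
      intro g hg hg'
      rw [mem_filter] at hg hg'
      have h1 := hg.2 a ha
      have h2 := hg'.2 a ha
      rw [Function.update_self] at h1 h2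
      exact hcc' (h1.symm.trans h2)

/-- Few assignments agree with `f` off `S` while using on `S` only colours that appear on `T`. -/
theorem card_assignments_eqOn_le (S T : Finset V) (hST : Disjoint S T) (f : V → Fin k)
    (Y : Finset (V → Fin k)) (hY : ∀ g ∈ Y, (∀ u ∉ S, g u = f u) ∧ ∀ u ∈ S, ∃ w ∈ T, g u = g w) :
    #Y ≤ #T ^ #S := by
  have hsub : Y ⊆ Fintype.piFinset fun u => if u ∈ S then T.image f else {f u} := by
    intro g hg
    rw [Fintype.mem_piFinset]
    intro u
    split_ifs with hu
    · obtain ⟨w, hw, hgw⟩ := (hY g hg).2 u hu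
      rw [mem_image]
      exact ⟨w, hw, by rw [hgw, (hY g hg).1 w (disjoint_right.1 hST hw)]⟩
    · exact mem_singleton.2 ((hY g hg).1 u hu)
  refine (card_le_card hsub).trans ?_
  rw [Fintype.card_piFinset]
  calc _ ≤ ∏ u : V, (if u ∈ S then #T else 1) := by
        refine prod_le_prod' fun u _ => ?_
        split_ifs
        · exact card_image_le
        · simp
    _ = #T ^ #S := by rw [prod_ite_mem, univ_inter, prod_const]

/-- Proper colourings in which `S` only repeats colours of `T` are rare, even conditionally on a
property `P` that does not depend on the colours on `S`. -/
theorem card_repeating_mul_le (m : ℕ) (hm : m + G.maxDegree ≤ k) (S T : Finset V)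
    (hST : Disjoint S T) (P : (V → Fin k) → Prop)
    (hP : ∀ f g : V → Fin k, (∀ u ∉ S, g u = f u) → P f → P g) :
    m ^ #S * #{f ∈ G.properAssignments k | P f ∧ ∀ u ∈ S, ∃ w ∈ T, f u = f w} ≤
      #T ^ #S * #{f ∈ G.properAssignments k | P f} := by
  set A := ({f ∈ G.properAssignments k | P f ∧ ∀ u ∈ S, ∃ w ∈ T, f u = f w} : Finset (V → Fin k))
    with hA
  set Z := ({f ∈ G.properAssignments k | P f} : Finset (V → Fin k)) with hZ
  -- Conditioning on the colours off `S` amounts to comparing the two counts on each fibre of `r`;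
  -- `P` is constant there.
  let r : (V → Fin k) → ({u // u ∉ S} → Fin k) := fun f u => f u
  have hAZ : A ⊆ Z := fun f hf => by
    rw [hA, mem_filter] at hf
    rw [hZ, mem_filter]
    exact ⟨hf.1, hf.2.1⟩
  rw [card_eq_sum_card_fiberwise (f := r) (s := A) (t := Z.image r)
      (fun f hf => mem_coe.2 (mem_image_of_mem r (hAZ hf))),
    card_eq_sum_card_image r Z, mul_sum, mul_sum]
  refine sum_le_sum fun τ hτ => ?_
  obtain ⟨f, hf, rfl⟩ := mem_image.1 hτ
  rw [hZ, mem_filter] at hf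
  have hr : ∀ g, r g = r f ↔ ∀ u ∉ S, g u = f u := fun g => by
    simp [r, funext_iff]
  rw [mul_comm]
  refine Nat.mul_le_mul ?_ ?_
  · refine card_assignments_eqOn_le S T hST f _ fun g hg => ?_
    rw [mem_filter, hA, mem_filter] at hg
    exact ⟨(hr g).1 hg.2, hg.1.2.2⟩
  · refine (G.pow_le_card_properAssignments_eqOn m hm S f
      fun a b _ _ => G.mem_properAssignments.1 hf.1 a b).trans (card_le_card fun g hg => ?_)
    rw [mem_filter] at hg
    rw [mem_filter, hZ, mem_filter]
    exact ⟨⟨hg.1, hP f g hg.2 hf.2⟩, (hr g).2 hg.2⟩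

/-! ### From few unique colours to a repeating set -/

/-- The set of colours that appear exactly once on the neighbourhood of `v`. -/
noncomputable def uniqueColours (f : V → Fin k) (v : V) : Finset (Fin k) :=
  {c | ∃! u, G.Adj v u ∧ f u = c}

/-- A colour that appears and is not unique takes up at least two neighbours. -/
theorem two_mul_card_image_le (f : V → Fin k) (v : V) :
    2 * #((G.neighborFinset v).image f) ≤ G.degree v + #(G.uniqueColours f v) := by
  set I := (G.neighborFinset v).image f with hI
  have hdeg : G.degree v = ∑ c ∈ I, #{u ∈ G.neighborFinset v | f u = c} := by
    rw [← card_neighborFinset_eq_degree]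
    exact card_eq_sum_card_image f _
  have hU : #(I ∩ G.uniqueColours f v) = ∑ c ∈ I, if c ∈ G.uniqueColours f v then 1 else 0 := by
    rw [← filter_mem_eq_inter, card_filter]
  have h1 : 2 * #I ≤ G.degree v + #(I ∩ G.uniqueColours f v) := by
    rw [hdeg, hU, ← sum_add_distrib, mul_comm, ← smul_eq_mul, ← sum_const]
    refine sum_le_sum fun c hc => ?_
    obtain ⟨u, hu, huc⟩ := mem_image.1 hc
    have hmem : u ∈ ({u ∈ G.neighborFinset v | f u = c} : Finset V) := mem_filter.2 ⟨hu, huc⟩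
    have hpos := card_pos.2 ⟨u, hmem⟩
    split_ifs with hcU
    · omega
    · by_contra hlt
      have hone : #{u ∈ G.neighborFinset v | f u = c} = 1 := by omega
      obtain ⟨w, hw⟩ := card_eq_one.1 hone
      refine hcU ?_
      simp only [uniqueColours, mem_filter, mem_univ, true_and]
      refine ⟨u, ⟨by simpa using hu, huc⟩, fun y hy => ?_⟩
      have hy' : y ∈ ({u ∈ G.neighborFinset v | f u = c} : Finset V) :=
        mem_filter.2 ⟨by simpa using hy.1, hy.2⟩
      rw [hw, mem_singleton] at hmem hy'
      rw [hmem, hy']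
  have h2 := card_le_card (inter_subset_right (s₁ := I) (s₂ := G.uniqueColours f v))
  omega

/-- Keep one representative in `N(v)` of each colour; `S` is drawn from the other neighbours, so the
representatives lie outside `S`. -/
theorem exists_repeating_subset (f : V → Fin k) (v : V) (h : ℕ)
    (hf : #(G.uniqueColours f v) < h) :
    ∃ S ∈ (G.neighborFinset v).powersetCard ((G.degree v - h) / 2),
      ∀ u ∈ S, ∃ w ∈ G.neighborFinset v \ S, f u = f w := by
  have hsec : ∀ c ∈ (G.neighborFinset v).image f, ∃ u ∈ G.neighborFinset v, f u = c :=
    fun c hc => mem_image.1 hc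
  have : Nonempty V := ⟨v⟩
  choose! r hr hfr using hsec
  set R := ((G.neighborFinset v).image f).image r with hR
  have hRcard : #R ≤ #((G.neighborFinset v).image f) := card_image_le
  have hRN : R ⊆ G.neighborFinset v := by
    intro u hu
    obtain ⟨c, hc, rfl⟩ := mem_image.1 hu
    exact hr c hc
  have himage := G.two_mul_card_image_le f v
  obtain ⟨S, hS, hScard⟩ := exists_subset_card_eq (s := G.neighborFinset v \ R)
    (n := (G.degree v - h) / 2) (by
      rw [card_sdiff_of_subset hRN, card_neighborFinset_eq_degree]
      omega)
  refine ⟨S, mem_powersetCard.2 ⟨hS.trans sdiff_subset, hScard⟩, fun u hu => ?_⟩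
  have hfu : f u ∈ (G.neighborFinset v).image f :=
    mem_image_of_mem f (mem_sdiff.1 (hS hu)).1
  refine ⟨r (f u), mem_sdiff.2 ⟨hr _ hfu, fun hrS => ?_⟩, (hfr _ hfu).symm⟩
  exact (mem_sdiff.1 (hS hrS)).2 (mem_image_of_mem r hfu)

/-! ### The numerical estimate -/

theorem four_mul_sq_mul_le {d h Δ s : ℕ} (hd : 16 * h ≤ d) (hΔ : d ≤ Δ) (h_pos : 1 ≤ h)
    (h_log : 20 * Real.log (Δ : ℝ) ≤ (h : ℝ)) (hs : s = (d - h) / 2) :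
    4 * (Δ * Δ) * (d.choose s * (d - s) ^ s) ≤ (3 * Δ) ^ s := by
  have hΔ16 : (16 : ℝ) ≤ Δ := by exact_mod_cast (by omega : 16 ≤ Δ)
  have hΔ0 : (0 : ℝ) < Δ := by linarith
  have hlog16 : 2 ≤ Real.log Δ := by
    have h1 : Real.log ((2 : ℝ) ^ 4) ≤ Real.log Δ := Real.log_le_log (by norm_num) (by linarith)
    rw [Real.log_pow] at h1
    have := Real.log_two_gt_d9
    push_cast at h1
    linarith
  have hh40 : (40 : ℝ) ≤ h := by linarith
  have hh40' : 40 ≤ h := by exact_mod_cast hh40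
  -- Rounding in `s` is absorbed because `d ≥ 16 * h ≥ 640`.
  have hs7 : 7 * d ≤ 16 * s := by omega
  have hsd : s ≤ d := by omega
  have hd0 : (0 : ℝ) < d := by exact_mod_cast (by omega : 0 < d)
  have hbase : ((d - s : ℕ) : ℝ) ≤ 3 / 16 * (3 * Δ) := by
    have h1 : (7 * d : ℝ) ≤ 16 * s := by exact_mod_cast hs7
    have h2 : (d : ℝ) ≤ Δ := by exact_mod_cast hΔ
    rw [Nat.cast_sub hsd]
    linarith
  -- Sixteenth powers keep the exponents integral; `2187 / 4096 = 2 ^ 16 * (3 / 16) ^ 7`.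
  have hX : (2 : ℝ) ^ d * (3 / 16) ^ s ≤ (2187 / 4096) ^ h := by
    refine le_of_pow_le_pow_left₀ (n := 16) (by norm_num) (by positivity) ?_
    calc ((2 : ℝ) ^ d * (3 / 16) ^ s) ^ 16 = (2 ^ 16) ^ d * (3 / 16) ^ (16 * s) := by
          rw [mul_pow, ← pow_mul, ← pow_mul, ← pow_mul, mul_comm d, mul_comm s]
      _ ≤ (2 ^ 16) ^ d * (3 / 16) ^ (7 * d) := by
          gcongr ?_ * ?_
          exact pow_le_pow_of_le_one (by norm_num) (by norm_num) hs7
      _ = (2187 / 4096) ^ d := by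
          rw [pow_mul, ← mul_pow]; norm_num
      _ ≤ (2187 / 4096) ^ (16 * h) := pow_le_pow_of_le_one (by norm_num) (by norm_num) hd
      _ = _ := by rw [mul_comm, pow_mul]
  have hexp : (2187 / 4096 : ℝ) ^ h ≤ Real.exp (-(h / 2)) := by
    have h1 : (2187 / 4096 : ℝ) ≤ Real.exp (-(1 / 2)) := by
      refine le_of_pow_le_pow_left₀ (n := 2) (by norm_num) (Real.exp_pos _).le ?_
      rw [← Real.exp_nat_mul]
      have h2 := Real.exp_one_lt_d9
      have : ((2 : ℕ) : ℝ) * -(1 / 2) = -1 := by norm_num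
      rw [this, Real.exp_neg, le_inv_comm₀ (by norm_num) (Real.exp_pos 1)]
      norm_num
      linarith
    calc _ ≤ Real.exp (-(1 / 2)) ^ h := by gcongr
      _ = _ := by rw [← Real.exp_nat_mul]; ring_nf
  -- The exponent splits as `1/2 = 2/5 + 1/20 + 1/20`: the first part pays for the factor 4, the
  -- others for the two factors `Δ`.
  have hsq : 4 * ((Δ : ℝ) * Δ) ≤ Real.exp (h / 2) := by
    have h1 : (Δ : ℝ) ≤ Real.exp (h / 20) := by
      rw [← Real.log_le_iff_le_exp hΔ0]; linarith
    have h2 : (4 : ℝ) ≤ Real.exp (2 * h / 5) := by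
      have := Real.add_one_le_exp (2 * h / 5 : ℝ)
      linarith
    calc 4 * ((Δ : ℝ) * Δ) ≤ Real.exp (2 * h / 5) * (Real.exp (h / 20) * Real.exp (h / 20)) := by
          gcongr
      _ = _ := by rw [← Real.exp_add, ← Real.exp_add]; ring_nf
  have hchoose : (d.choose s : ℝ) ≤ 2 ^ d := by exact_mod_cast Nat.choose_le_two_pow d s
  have hfinal : 4 * ((Δ : ℝ) * Δ) * (d.choose s * ((d - s : ℕ) : ℝ) ^ s) ≤ (3 * Δ) ^ s := by
    calc _ ≤ Real.exp (h / 2) * (2 ^ d * (3 / 16 * (3 * Δ)) ^ s) := by gcongr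
      _ = Real.exp (h / 2) * (2 ^ d * (3 / 16) ^ s) * (3 * Δ) ^ s := by rw [mul_pow]; ring
      _ ≤ Real.exp (h / 2) * Real.exp (-(h / 2)) * (3 * Δ) ^ s := by
          gcongr; exact hX.trans hexp
      _ = _ := by rw [← Real.exp_add]; simp
  exact_mod_cast hfinal

/-! ### Applying the local lemma -/

omit [Fintype V] [DecidableRel G.Adj] in
theorem uniqueColours_congr {f g : V → Fin k} {v : V} (hfg : ∀ u, G.Adj v u → g u = f u) :
    G.uniqueColours g v = G.uniqueColours f v := by
  ext c
  simp only [uniqueColours, mem_filter, mem_univ, true_and]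
  refine existsUnique_congr fun u => and_congr_right fun hu => by rw [hfg u hu]

/-- Recolouring any `S ⊆ N(v)` preserves `P`, so the union bound over `S` holds conditionally on
`P`. -/
theorem card_few_uniqueColours_le {Δ : ℕ} (hΔ : G.maxDegree = Δ) (h : ℕ) (h_pos : 1 ≤ h)
    (h_log : 20 * Real.log (Δ : ℝ) ≤ (h : ℝ)) (h_min : 16 * h ≤ G.minDegree)
    (v : V) (P : (V → Fin (4 * Δ)) → Prop)
    (hP : ∀ f g : V → Fin (4 * Δ), (∀ u, ¬ G.Adj v u → g u = f u) → P f → P g) :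
    4 * (Δ * Δ) *
        #{f ∈ G.properAssignments (4 * Δ) | #(G.uniqueColours f v) < h ∧ P f} ≤
      #{f ∈ G.properAssignments (4 * Δ) | P f} := by
  set d := G.degree v with hd
  set s := (d - h) / 2 with hs
  have hdΔ : d ≤ Δ := hΔ ▸ G.degree_le_maxDegree v
  have hhd : 16 * h ≤ d := h_min.trans (G.minDegree_le_degree v)
  set Z := #{f ∈ G.properAssignments (4 * Δ) | P f} with hZ
  set N := (G.neighborFinset v).powersetCard s with hN
  have hcover : ({f ∈ G.properAssignments (4 * Δ) | #(G.uniqueColours f v) < h ∧ P f} :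
      Finset (V → Fin (4 * Δ))) ⊆ N.biUnion fun S => {f ∈ G.properAssignments (4 * Δ) |
        P f ∧ ∀ u ∈ S, ∃ w ∈ G.neighborFinset v \ S, f u = f w} := by
    intro f hf
    rw [mem_filter] at hf
    obtain ⟨S, hS, hSf⟩ := G.exists_repeating_subset f v h hf.2.1
    exact mem_biUnion.2 ⟨S, hS, mem_filter.2 ⟨hf.1, hf.2.2, hSf⟩⟩
  have hNcard : #N = d.choose s := by rw [hN, card_powersetCard, card_neighborFinset_eq_degree]
  have hpos : 0 < (3 * Δ) ^ s := pow_pos (by omega) _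
  refine Nat.le_of_mul_le_mul_left ?_ hpos
  set W := #{f ∈ G.properAssignments (4 * Δ) | #(G.uniqueColours f v) < h ∧ P f}
  calc (3 * Δ) ^ s * (4 * (Δ * Δ) * W) = 4 * (Δ * Δ) * ((3 * Δ) ^ s * W) := by ring
    _ ≤ 4 * (Δ * Δ) * ((3 * Δ) ^ s * ∑ S ∈ N, #{f ∈ G.properAssignments (4 * Δ) |
        P f ∧ ∀ u ∈ S, ∃ w ∈ G.neighborFinset v \ S, f u = f w}) := by
        gcongr; exact (card_le_card hcover).trans card_biUnion_le
    _ ≤ 4 * (Δ * Δ) * ∑ S ∈ N, (d - s) ^ s * Z := by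
        rw [mul_sum]
        refine Nat.mul_le_mul_left _ (sum_le_sum fun S hS => ?_)
        obtain ⟨hSN, hScard⟩ := mem_powersetCard.1 hS
        have hT : #(G.neighborFinset v \ S) = d - s := by
          rw [card_sdiff_of_subset hSN, hScard, card_neighborFinset_eq_degree]
        have := G.card_repeating_mul_le (3 * Δ) (by omega) S (G.neighborFinset v \ S)
          disjoint_sdiff P fun f g hfg => hP f g fun u hu => hfg u fun huS =>
            hu (by simpa using hSN huS)
        rwa [hScard, hT] at this
    _ = 4 * (Δ * Δ) * (d.choose s * (d - s) ^ s) * Z := by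
        rw [sum_const, smul_eq_mul, hNcard]; ring
    _ ≤ (3 * Δ) ^ s * Z := by
        gcongr
        exact four_mul_sq_mul_le hhd hdΔ h_pos h_log hs

theorem exists_isPcfColouring (h : ℕ) (h_pos : 1 ≤ h)
    (h_log : 20 * Real.log (G.maxDegree : ℝ) ≤ (h : ℝ)) (h_min : 16 * h ≤ G.minDegree) :
    ∃ σ : G.Coloring (Fin (4 * G.maxDegree)), G.IsPcfColouring h σ := by
  have hΔ : 0 < G.maxDegree := by
    have := G.minDegree_le_maxDegree
    omega
  have hne : (G.properAssignments (4 * G.maxDegree)).Nonempty := by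
    have := G.pow_le_card_properAssignments_eqOn (k := 4 * G.maxDegree) (3 * G.maxDegree)
      (by omega) univ (fun _ => ⟨0, by omega⟩) (by simp)
    have h2 : 0 < (3 * G.maxDegree) ^ #(univ : Finset V) := pow_pos (by omega) _
    obtain ⟨f, hf⟩ := card_pos.1 (h2.trans_le this)
    exact ⟨f, (mem_filter.1 hf).1⟩
  obtain ⟨f, hf, hgood⟩ := Finset.exists_avoiding_of_card_le (G.properAssignments _) hne
    (fun v f => #(G.uniqueColours f v) < h)
    -- If `w` is outside this set, `N(w)` and `N(v)` are disjoint, so the event at `w` ignores the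
    -- colours on `N(v)`.
    (fun v => (G.neighborFinset v).biUnion fun u => G.neighborFinset u)
    (G.maxDegree * G.maxDegree) (Nat.mul_pos hΔ hΔ)
    (fun v => by
      refine (card_biUnion_le_card_mul _ _ G.maxDegree fun u _ => ?_).trans ?_
      · simpa using G.degree_le_maxDegree u
      · gcongr
        simpa using G.degree_le_maxDegree v)
    (fun v F hF => by
      convert G.card_few_uniqueColours_le rfl h h_pos h_log h_min v
        (fun f => ∀ w ∈ F, ¬ #(G.uniqueColours f w) < h) fun f g hfg hf w hw => ?_
      rw [G.uniqueColours_congr (f := f)]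
      · exact hf w hw
      · intro u hwu
        refine hfg u fun hvu => Finset.disjoint_left.1 hF hw ?_
        simp only [mem_biUnion, mem_neighborFinset]
        exact ⟨u, hvu, hwu.symm⟩)
  refine ⟨Coloring.mk f fun {a b} hab => G.mem_properAssignments.1 hf a b hab, fun v => ?_⟩
  have hset : G.solitaryColours
      (Coloring.mk f fun {a b} hab => G.mem_properAssignments.1 hf a b hab) v =
      (G.uniqueColours f v : Set (Fin (4 * G.maxDegree))) := by
    ext c
    simp only [solitaryColours, uniqueColours, coe_filter, mem_univ, true_and]
    rfl
  rw [hset, Set.ncard_coe_finset]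
  exact (min_le_left _ _).trans (not_lt.1 (hgood v))

end SimpleGraph

theorem mainTheorem4 {V : Type*} [Fintype V] (G : SimpleGraph V) [DecidableRel G.Adj]
    (h : ℕ) (h_pos : 1 ≤ h)
    (h_log : 20 * Real.log (G.maxDegree : ℝ) ≤ (h : ℝ))
    (h_min : 16 * h ≤ G.minDegree) :
    G.pcfChromaticNumber h ≤ 4 * (G.maxDegree : ℕ∞) := by
  have := iInf₂_le (f := fun (k : ℕ) (_ : k ∈ {k : ℕ | ∃ σ : G.Coloring (Fin k),
    G.IsPcfColouring h σ}) => (k : ℕ∞)) (4 * G.maxDegree)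
    (G.exists_isPcfColouring h h_pos h_log h_min)
  simpa [SimpleGraph.pcfChromaticNumber] using this
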